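/- Let $G$ be a finite normal-form game with finitely many players $i\in[N]$, finite nonempty action sets $A_i$ and utilities $u_i:\prod_j A_j\to\mathbb R$, extended to mixed profiles $\boldsymbol\pi=(\pi_i,\pi_{-i})$, $\pi_i\in\Delta(A_i)$ (the probability simplex in $\mathbb R^{A_i}$), by the multilinear formula $u_i(\boldsymbol\pi)=\sum_{a}\big(\prod_j\pi_j(a_j)\big)u_i(a)$. Let $\lambda_i\in\mathbb R$ and let $f_i$ be real-valued functions on $\mathbb R^{A_i}$. A generalized quantal response equilibrium (GQRE) of $G$ is a profile $\boldsymbol\pi^*\in\prod_i\Delta(A_i)$ with $$\pi_i^*\in\operatorname*{arg\,max}_{\pi_i\in\Delta(A_i)}\ \lambda_i u_i(\pi_i,\pi_{-i}^*)-f_i(\pi_i)\qquad\text{for every } i\in[N].$$ The perturbed game $G_f$ has strategy sets $\Delta(A_i)$ and payoffs $u_i^{f_i}(\boldsymbol\pi)=\lambda_i u_i(\boldsymbol\pi)-f_i(\pi_i)$. 1. A profile is a GQRE of $G$ if and only if it is a Nash equilibrium of $G_f$. 2. If every $f_i$ is convex and continuous on $\Delta(A_i)$, then $G_f$ is a concave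 game (the strategy sets are nonempty, compact and convex, and each payoff is continuous on $\prod_j\Delta(A_j)$ and concave in the player's own strategy), and $G$ has a GQRE. 3. Suppose that every $f_i$ is twice differentiable at every point of $\Delta(A_i)$, as a function on a neighbourhood of that point in $\mathbb R^{A_i}$, and let $H(\boldsymbol\pi)$ be the matrix with entries $H_{(i,a_i),(j,a_j)}(\boldsymbol\pi)=\dfrac{\partial^2 u_i^{f_i}(\boldsymbol\pi)}{\partial\pi_{i,a_i}\,\partial\pi_{j,a_j}}$ for $i,j\in[N]$, $a_i\in A_i$, $a_j\in A_j$. If $H(\boldsymbol\pi)+H(\boldsymbol\pi)^{T}$ is negative definite for all $\boldsymbol\pi\in\prod_i\Delta(A_i)$, then $G$ has exactly one GQRE. -/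

import Mathlib

open scoped Topology

noncomputable section

/-- A game in which player `i` picks a point of the set `strategies i` of the vector space `E i`
and receives `payoff i x` at the profile `x`. -/
structure StrategicGame (ι : Type*) (E : ι → Type*) where
  /-- The strategy set of each player. -/
  strategies : ∀ i, Set (E i)
  /-- The payoff function of each player. -/
  payoff : ι → (∀ i, E i) → ℝ

namespace StrategicGame

/-- `x` is a Nash equilibrium: it is feasible, and no player gains by a unilateral deviation. -/
def IsNash {ι : Type*} [DecidableEq ι] {E : ι → Type*} (G : StrategicGame ι E)
    (x : ∀ i, E i) : Prop :=
  (∀ i, x i ∈ G.strategies i) ∧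
    ∀ i, ∀ y ∈ G.strategies i, G.payoff i (Function.update x i y) ≤ G.payoff i x

/-- Concave games in the sense of Rosen (product strategy space): strategy sets are nonempty,
compact and convex, payoffs are continuous in the whole profile, and each player's payoff is
concave in that player's own strategy. -/
structure IsConcaveGame {ι : Type*} [DecidableEq ι] {E : ι → Type*}
    [∀ i, AddCommGroup (E i)] [∀ i, Module ℝ (E i)] [∀ i, TopologicalSpace (E i)]
    (G : StrategicGame ι E) : Prop where
  nonempty : ∀ i, (G.strategies i).Nonempty
  compact : ∀ i, IsCompact (G.strategies i)
  convex : ∀ i, Convex ℝ (G.strategies i)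
  continuous_payoff : ∀ i, ContinuousOn (G.payoff i) (Set.univ.pi G.strategies)
  concave_payoff : ∀ i, ∀ x ∈ Set.univ.pi G.strategies,
    ConcaveOn ℝ (G.strategies i) (fun y => G.payoff i (Function.update x i y))

/-- The partial derivative `∂g/∂π_{j,b}` at `π` of a function `g` of profiles, `k = (j, b)`. -/
def partialDeriv {ι : Type*} [DecidableEq ι] {A : ι → Type*} [∀ i, DecidableEq (A i)]
    (g : (∀ i, A i → ℝ) → ℝ) (k : Σ i, A i) (π : ∀ i, A i → ℝ) : ℝ :=
  lineDeriv ℝ g π (Pi.single k.1 (Pi.single k.2 1))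

/-- The Jacobian `H(π)` of the field of own-payoff gradients: the entry at `((i, a), (j, b))` is
the second partial derivative of the payoff of player `i` in `π_{i,a}` and `π_{j,b}`. -/
def gradJacobian {ι : Type*} [DecidableEq ι] {A : ι → Type*} [∀ i, DecidableEq (A i)]
    (G : StrategicGame ι (fun i => A i → ℝ)) (π : ∀ i, A i → ℝ) :
    Matrix (Σ i, A i) (Σ i, A i) ℝ :=
  Matrix.of fun k l => partialDeriv (partialDeriv (G.payoff k.1) k) l π

/-- Strict diagonal dominance: `H(π) + H(π)ᵀ` is negative definite at every feasible profile. -/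
def StrictDiagonalDominance {ι : Type*} [DecidableEq ι] {A : ι → Type*}
    [∀ i, DecidableEq (A i)] (G : StrategicGame ι (fun i => A i → ℝ)) : Prop :=
  ∀ π : ∀ i, A i → ℝ, (∀ i, π i ∈ G.strategies i) →
    (-(G.gradJacobian π + (G.gradJacobian π).transpose)).PosDef

end StrategicGame

/-- `f` is twice differentiable at `x`: differentiable near `x`, with derivative differentiable
at `x`. -/
def TwiceDifferentiableAt {E : Type*} [NormedAddCommGroup E] [NormedSpace ℝ E] (f : E → ℝ)
    (x : E) : Prop :=
  (∀ᶠ y in 𝓝 x, DifferentiableAt ℝ f y) ∧ DifferentiableAt ℝ (fderiv ℝ f) x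

/-- Multilinear extension of the utility table `v`: at mixed profiles, the expected utility when
the players randomize independently. -/
def expectedUtility {ι : Type*} [Fintype ι] [DecidableEq ι] {A : ι → Type*}
    [∀ i, Fintype (A i)] (v : (∀ i, A i) → ℝ) (π : ∀ i, A i → ℝ) : ℝ :=
  ∑ a : ∀ i, A i, (∏ j, π j (a j)) * v a

/-- The generalized quantal response of player `i` to `π₋ᵢ`: the set of maximizers over the
simplex of `λᵢ uᵢ(·, π₋ᵢ) - fᵢ`. The component `π i` is irrelevant. -/
def generalizedQuantalResponse {ι : Type*} [Fintype ι] [DecidableEq ι] {A : ι → Type*}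
    [∀ i, Fintype (A i)] (u : ι → (∀ i, A i) → ℝ) (lam : ι → ℝ)
    (f : ∀ i, (A i → ℝ) → ℝ) (i : ι) (π : ∀ i, A i → ℝ) : Set (A i → ℝ) :=
  {p | p ∈ stdSimplex ℝ (A i) ∧
    IsMaxOn (fun q => lam i * expectedUtility (u i) (Function.update π i q) - f i q)
      (stdSimplex ℝ (A i)) p}

/-- The joint response correspondence. -/
def gqreCorrespondence {ι : Type*} [Fintype ι] [DecidableEq ι] {A : ι → Type*}
    [∀ i, Fintype (A i)] (u : ι → (∀ i, A i) → ℝ) (lam : ι → ℝ)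
    (f : ∀ i, (A i → ℝ) → ℝ) (π : ∀ i, A i → ℝ) : Set (∀ i, A i → ℝ) :=
  {ρ | ∀ i, ρ i ∈ generalizedQuantalResponse u lam f i π}

/-- A generalized quantal response equilibrium is a fixed point of the response correspondence. -/
def IsGQRE {ι : Type*} [Fintype ι] [DecidableEq ι] {A : ι → Type*}
    [∀ i, Fintype (A i)] (u : ι → (∀ i, A i) → ℝ) (lam : ι → ℝ)
    (f : ∀ i, (A i → ℝ) → ℝ) (π : ∀ i, A i → ℝ) : Prop :=
  π ∈ gqreCorrespondence u lam f π

/-- The perturbed game: strategy sets are the simplices, payoffs are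
`λᵢ uᵢ(π) - fᵢ(πᵢ)`. -/
def perturbedGame {ι : Type*} [Fintype ι] [DecidableEq ι] {A : ι → Type*}
    [∀ i, Fintype (A i)] (u : ι → (∀ i, A i) → ℝ) (lam : ι → ℝ)
    (f : ∀ i, (A i → ℝ) → ℝ) : StrategicGame ι (fun i => A i → ℝ) where
  strategies := fun i => stdSimplex ℝ (A i)
  payoff := fun i π => lam i * expectedUtility (u i) π - f i (π i)

end

/-! The equivalence of GQRE and Nash equilibrium is a matter of unfolding.

For existence, a perturbed payoff is affine minus convex in the player's own strategy, so
`perturbedGame` is a concave game. Its equilibria come from Ky Fan's inequality applied to the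
Nikaido–Isoda function `Φ x y = ∑ i, (payoff i (y i, x₋ᵢ) - payoff i x)`, which vanishes on the
diagonal. Ky Fan's inequality reduces by compactness to finitely many test points, hence to a
KKM-type covering theorem on a simplex. That theorem is the limit of Scarf's combinatorial lemma on
finer and finer grids, and Scarf's lemma is a parity count.

Uniqueness is Rosen's argument. Negative definiteness makes the field of own-payoff gradients,
paired with `y - x`, strictly decreasing along the segment from `x` to `y`, while the first-order
conditions at two equilibria force the opposite inequality. The diagonal blocks of the same
hypothesis yield concavity, so existence follows without assuming the `f i` convex. -/

/-- Given rank functions `r i` on `X`, a finite set `R` is dominant if no element of `X` is, for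
every `i`, ranked above the lowest-ranked element of `R`. -/
def IsDominant {X I L : Type*} [LinearOrder L] (r : I → X → L) (R : Finset X) : Prop :=
  ∀ y, ∃ i, ∀ x ∈ R, r i y ≤ r i x

/-! ### Scarf's lemma by counting doors and rooms -/

section Scarf

variable {X I L : Type*} [LinearOrder L] {r : I → X → L}

theorem IsDominant.mono {R R' : Finset X} (h : IsDominant r R') (hR : R ⊆ R') :
    IsDominant r R := fun y =>
  (h y).imp fun _ hi x hx => hi x (hR hx)

variable [DecidableEq X] [Fintype I] [DecidableEq I]

/-- If `μ i` is the `r i`-minimum of `D` and `insert x D` is dominant of full cardinality, then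
`x` takes over the minimum of exactly one index `j`, one of two indices sharing their minimum. -/
theorem IsDominant.exists_index_of_insert (hr : ∀ i, Function.Injective (r i)) {D : Finset X}
    (hcard : D.card + 1 = Fintype.card I) {μ : I → X} (hμD : ∀ i, μ i ∈ D)
    (hμ : ∀ i, ∀ x ∈ D, r i (μ i) ≤ r i x) {a b : I} (hab : a ≠ b) (hμab : μ a = μ b)
    {x : X} (hx : x ∉ D) (hdom : IsDominant r (insert x D)) :
    ∃ j, (j = a ∨ j = b) ∧ (∀ i, i ≠ j → r i (μ i) < r i x) ∧
      ∀ y, (∀ i, i ≠ j → r i (μ i) < r i y) → r j y ≤ r j x := by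
  -- Each `y ∈ D` is the minimum of `D` at `ind y`, so `ind` is injective on `D` with left inverse
  -- `μ`. It misses `ind x`, hence by cardinality hits every other index, and the required `j` is
  -- `ind x`.
  choose ind hind using hdom
  have hμind : ∀ y ∈ D, μ (ind y) = y := fun y hy =>
    hr (ind y) (le_antisymm (hμ _ _ hy) (hind y _ (Finset.mem_insert_of_mem (hμD _))))
  have hlt : ∀ y ∈ D, r (ind y) y < r (ind y) x := fun y hy =>
    lt_of_le_of_ne (hind y x (Finset.mem_insert_self _ _))
      fun h => hx (hr _ h ▸ hy)
  have hne : ∀ y ∈ D, ind y ≠ ind x := fun y hy h => by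
    have h1 := hlt y hy
    have h2 := hind x y (Finset.mem_insert_of_mem hy)
    rw [← h] at h2
    exact absurd h1 (not_lt.mpr h2)
  have himage : D.image ind = Finset.univ.erase (ind x) := by
    apply Finset.eq_of_subset_of_card_le
    · intro i hi
      obtain ⟨y, hy, rfl⟩ := Finset.mem_image.mp hi
      exact Finset.mem_erase.mpr ⟨hne y hy, Finset.mem_univ _⟩
    · rw [Finset.card_image_of_injOn, Finset.card_erase_of_mem (Finset.mem_univ _),
        Finset.card_univ]
      · omega
      · intro y hy z hz hyz
        rw [← hμind y hy, ← hμind z hz, hyz]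
  have hex : ∀ i, i ≠ ind x → ∃ y ∈ D, ind y = i := fun i hi =>
    Finset.mem_image.mp (himage ▸ Finset.mem_erase.mpr ⟨hi, Finset.mem_univ _⟩)
  have hbelow : ∀ i, i ≠ ind x → r i (μ i) < r i x := fun i hi => by
    obtain ⟨y, hy, rfl⟩ := hex i hi
    rw [hμind y hy]
    exact hlt y hy
  refine ⟨ind x, ?_, hbelow, fun y hy => ?_⟩
  · by_contra! h
    obtain ⟨y, hy, rfl⟩ := hex a h.1.symm
    obtain ⟨z, hz, rfl⟩ := hex b h.2.symm
    rw [hμind y hy, hμind z hz] at hμab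
    exact hab (congrArg ind hμab)
  · have hi : ind y = ind x := by
      by_contra h
      exact absurd (hy _ h) (not_lt.mpr (hind y _ (Finset.mem_insert_of_mem (hμD _))))
    rw [← hi]
    exact hind y x (Finset.mem_insert_self _ _)

omit [Fintype I] [DecidableEq I] in
/-- A top-ranked element, for `j`, among those lying above the other minima of a dominant set `D`
can be added to `D`, when `j` shares its minimum with another index. -/
theorem IsDominant.insert_of_maximal (hr : ∀ i, Function.Injective (r i)) {D : Finset X}
    (hD : IsDominant r D) {μ : I → X} (hμD : ∀ i, μ i ∈ D)
    (hμ : ∀ i, ∀ x ∈ D, r i (μ i) ≤ r i x) {j k : I} (hjk : k ≠ j)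
    (hμjk : μ j = μ k) {x : X} (hx : ∀ i, i ≠ j → r i (μ i) < r i x)
    (hmax : ∀ y, (∀ i, i ≠ j → r i (μ i) < r i y) → r j y ≤ r j x) :
    x ∉ D ∧ IsDominant r (insert x D) := by
  have hjx : ∀ y ∈ D, r j x ≤ r j y := by
    obtain ⟨i, hi⟩ := hD x
    rcases eq_or_ne i j with rfl | hij
    · exact hi
    · exact absurd (hx i hij) (not_lt.mpr (hi _ (hμD i)))
  refine ⟨fun hxD => ?_, fun y => ?_⟩
  · have h : x = μ k := hμjk ▸ hr j (le_antisymm (hjx _ (hμD j)) (hμ j x hxD))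
    exact absurd (hx k hjk) (by rw [h]; exact lt_irrefl _)
  · by_cases hy : ∀ i, i ≠ j → r i (μ i) < r i y
    · refine ⟨j, fun z hz => (hmax y hy).trans ?_⟩
      rcases Finset.mem_insert.mp hz with rfl | hz
      · exact le_rfl
      · exact hjx z hz
    · push Not at hy
      obtain ⟨i, hij, hi⟩ := hy
      refine ⟨i, fun z hz => hi.trans ?_⟩
      rcases Finset.mem_insert.mp hz with rfl | hz
      · exact (hx i hij).le
      · exact hμ i z hz

variable [Fintype X] {s : I → X}

/-- A dominant set of cardinality one less than the number of indices, not consisting of slack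
elements only, can be completed to a dominant set in exactly two ways. -/
theorem IsDominant.card_insert_eq_two (hr : ∀ i, Function.Injective (r i))
    (hs : Function.Injective s) (hmin : ∀ i x, r i (s i) ≤ r i x)
    (htop : ∀ i j, j ≠ i → ∀ x ∉ Set.range s, r i x < r i (s j)) {D : Finset X}
    (hD : IsDominant r D) (hcard : D.card + 1 = Fintype.card I) {t : X} (ht : t ∈ D)
    (hts : t ∉ Set.range s) [DecidablePred fun x => x ∉ D ∧ IsDominant r (insert x D)] :
    (Finset.univ.filter fun x => x ∉ D ∧ IsDominant r (insert x D)).card = 2 := by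
  have hex : ∀ i, ∃ m ∈ D, ∀ x ∈ D, r i m ≤ r i x := fun i =>
    Finset.exists_min_image D (r i) ⟨t, ht⟩
  choose μ hμD hμ using hex
  obtain ⟨a, b, hab, hμab⟩ : ∃ a b, a ≠ b ∧ μ a = μ b := by
    obtain ⟨a, -, b, -, hab, h⟩ := Finset.exists_ne_map_eq_of_card_lt_of_maps_to
      (s := Finset.univ) (t := D) (by rw [Finset.card_univ]; omega) (fun i _ => hμD i)
    exact ⟨a, b, hab, h⟩
  have hmax : ∀ j, ∃ x, (∀ i, i ≠ j → r i (μ i) < r i x) ∧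
      ∀ y, (∀ i, i ≠ j → r i (μ i) < r i y) → r j y ≤ r j x := by
    classical
    intro j
    -- `s j` is a candidate: at `i ≠ j` it lies above every non-slack element, and a slack minimum
    -- `μ i` must be `s i`, since any other slack element would exceed `t ∈ D`.
    obtain ⟨x, hx, hxm⟩ := Finset.exists_max_image
      (Finset.univ.filter fun x => ∀ i, i ≠ j → r i (μ i) < r i x) (r j) ⟨s j, by
        simp only [Finset.mem_filter, Finset.mem_univ, true_and]
        intro i hij
        by_cases hi : μ i ∈ Set.range s
        · obtain ⟨k, hk⟩ := hi
          have hki : k = i := by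
            by_contra hki
            exact absurd (hμ i t ht) (not_le.mpr (hk ▸ htop i k hki t hts))
          subst hki
          rw [← hk]
          exact lt_of_le_of_ne (hmin _ _) fun h => hij (hs (hr _ h))
        · exact htop i j hij.symm _ hi⟩
    exact ⟨x, (Finset.mem_filter.mp hx).2, fun y hy =>
      hxm y (Finset.mem_filter.mpr ⟨Finset.mem_univ _, hy⟩)⟩
  choose ξ hξ hξmax using hmax
  rw [Finset.card_eq_two]
  -- If the two completions coincided, that element would exceed the minimum of `D` at every index,
  -- against dominance.
  refine ⟨ξ a, ξ b, fun h => ?_, ?_⟩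
  · have h1 := hξ b a hab
    obtain ⟨i, hi⟩ := hD (ξ a)
    have hia : i = a := by
      by_contra hia
      exact absurd (hξ a i hia) (not_lt.mpr (hi _ (hμD i)))
    subst hia
    exact absurd (h ▸ h1) (not_lt.mpr (hi _ (hμD i)))
  · ext x
    simp only [Finset.mem_filter, Finset.mem_univ, true_and, Finset.mem_insert,
      Finset.mem_singleton]
    constructor
    · rintro ⟨hx, hdom⟩
      obtain ⟨j, hj, hjx, hjm⟩ :=
        IsDominant.exists_index_of_insert hr hcard hμD hμ hab hμab hx hdom
      have : x = ξ j := hr j (le_antisymm (hξmax j x hjx) (hjm _ (hξ j)))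
      rcases hj with rfl | rfl
      · exact Or.inl this
      · exact Or.inr this
    · rintro (rfl | rfl)
      · exact hD.insert_of_maximal hr hμD hμ hab.symm hμab (hξ a) (hξmax a)
      · exact hD.insert_of_maximal hr hμD hμ hab hμab.symm (hξ b) (hξmax b)

/-- The slack elements other than `s i₀` can be completed to a dominant set in a unique way. -/
theorem card_insert_slack_eq_one (hr : ∀ i, Function.Injective (r i))
    (hmin : ∀ i x, r i (s i) ≤ r i x)
    (htop : ∀ i j, j ≠ i → ∀ x ∉ Set.range s, r i x < r i (s j)) {t : X}
    (hts : t ∉ Set.range s) (i₀ : I)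
    [DecidablePred fun x => x ∉ (Finset.univ.erase i₀).image s ∧
      IsDominant r (insert x ((Finset.univ.erase i₀).image s))] :
    (Finset.univ.filter fun x => x ∉ (Finset.univ.erase i₀).image s ∧
      IsDominant r (insert x ((Finset.univ.erase i₀).image s))).card = 1 := by
  classical
  -- The unique completion is the non-slack element ranked highest by `r i₀`. Adding `s i₀` instead
  -- fails, since `m` exceeds every `s i` at `i`.
  obtain ⟨m, hm, hmm⟩ := Finset.exists_max_image
    (Finset.univ.filter fun x => x ∉ Set.range s) (r i₀) ⟨t, by simpa using hts⟩
  replace hm : m ∉ Set.range s := (Finset.mem_filter.mp hm).2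
  replace hmm : ∀ x ∉ Set.range s, r i₀ x ≤ r i₀ m := fun x hx =>
    hmm x (Finset.mem_filter.mpr ⟨Finset.mem_univ _, hx⟩)
  have hmem : ∀ i, i ≠ i₀ → s i ∈ (Finset.univ.erase i₀).image s := fun i hi =>
    Finset.mem_image_of_mem _ (Finset.mem_erase.mpr ⟨hi, Finset.mem_univ _⟩)
  have hns : ∀ x ∉ Set.range s, ∀ i, ¬ r i x ≤ r i (s i) := fun x hx i h =>
    hx ⟨i, hr i (le_antisymm (hmin i x) h)⟩
  rw [Finset.card_eq_one]
  refine ⟨m, ?_⟩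
  ext x
  simp only [Finset.mem_filter, Finset.mem_univ, true_and, Finset.mem_singleton]
  constructor
  · rintro ⟨hx, hdom⟩
    have hxs : x ∉ Set.range s := by
      rintro ⟨k, rfl⟩
      have hk : k = i₀ := by
        by_contra hk
        exact hx (hmem k hk)
      subst hk
      obtain ⟨i, hi⟩ := hdom m
      refine hns m hm i (hi _ ?_)
      rcases eq_or_ne i k with rfl | hik
      · exact Finset.mem_insert_self _ _
      · exact Finset.mem_insert_of_mem (hmem i hik)
    obtain ⟨i, hi⟩ := hdom m
    have hii : i = i₀ := by
      by_contra hii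
      exact hns m hm i (hi _ (Finset.mem_insert_of_mem (hmem i hii)))
    subst hii
    exact hr i (le_antisymm (hmm x hxs) (hi x (Finset.mem_insert_self _ _)))
  · rintro rfl
    refine ⟨fun hx => ?_, fun y => ?_⟩
    · obtain ⟨k, -, hk⟩ := Finset.mem_image.mp hx
      exact hm ⟨k, hk⟩
    · by_cases hy : y ∈ Set.range s
      · obtain ⟨k, rfl⟩ := hy
        exact ⟨k, fun z _ => hmin k z⟩
      · refine ⟨i₀, fun z hz => ?_⟩
        rcases Finset.mem_insert.mp hz with rfl | hz
        · exact hmm y hy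
        · obtain ⟨k, hk, rfl⟩ := Finset.mem_image.mp hz
          exact (htop i₀ k (Finset.ne_of_mem_erase hk) y hy).le

omit [Fintype X] in
/-- A set coloured with too few colours has an even number of facets whose colours are exactly
all colours but `i₀`. -/
theorem even_card_filter_image_erase {c : X → I} {R : Finset X} (hcard : R.card = Fintype.card I)
    (hR : R.image c ≠ Finset.univ) (i₀ : I) :
    Even (R.filter fun x => (R.erase x).image c = Finset.univ.erase i₀).card := by
  by_cases hempty : (R.filter fun x => (R.erase x).image c = Finset.univ.erase i₀) = ∅
  · rw [hempty]; exact ⟨0, rfl⟩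
  obtain ⟨x, hx⟩ := Finset.nonempty_iff_ne_empty.mpr hempty
  obtain ⟨hxR, hx⟩ := Finset.mem_filter.mp hx
  have hinj : ∀ z ∈ R, (R.erase z).image c = Finset.univ.erase i₀ →
      Set.InjOn c (R.erase z : Finset X) := fun z hz h => by
    rw [← Finset.card_image_iff, h, Finset.card_erase_of_mem hz,
      Finset.card_erase_of_mem (Finset.mem_univ _), Finset.card_univ, hcard]
  -- The colour of `x` therefore repeats in `R`, at a unique `x'`. Only removing `x` or `x'` leaves
  -- each colour other than `i₀` exactly once.
  have hcx : c x ≠ i₀ := fun h => hR <| by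
    rw [← Finset.insert_erase hxR, Finset.image_insert, hx, h,
      Finset.insert_erase (Finset.mem_univ _)]
  obtain ⟨x', hx', hcx'⟩ : ∃ x' ∈ R.erase x, c x' = c x :=
    Finset.mem_image.mp (hx ▸ Finset.mem_erase.mpr ⟨hcx, Finset.mem_univ _⟩)
  obtain ⟨hne, hx'R⟩ := Finset.mem_erase.mp hx'
  suffices h : (R.filter fun x => (R.erase x).image c = Finset.univ.erase i₀) = {x, x'} by
    rw [h, Finset.card_pair hne.symm]
    exact even_two
  ext z
  simp only [Finset.mem_filter, Finset.mem_insert, Finset.mem_singleton]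
  constructor
  · rintro ⟨hz, h⟩
    by_contra! hzx
    exact hne (hinj z hz h (Finset.mem_coe.mpr (Finset.mem_erase.mpr ⟨hzx.2.symm, hx'R⟩))
      (Finset.mem_coe.mpr (Finset.mem_erase.mpr ⟨hzx.1.symm, hxR⟩)) hcx')
  · rintro (rfl | rfl)
    · exact ⟨hxR, hx⟩
    · refine ⟨hx'R, hx ▸ ?_⟩
      ext i
      simp only [Finset.mem_image, Finset.mem_erase]
      constructor
      · rintro ⟨y, ⟨hy1, hy2⟩, rfl⟩
        rcases eq_or_ne y x with rfl | hyx
        · exact ⟨z, ⟨hne, hx'R⟩, hcx'⟩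
        · exact ⟨y, ⟨hyx, hy2⟩, rfl⟩
      · rintro ⟨y, ⟨hy1, hy2⟩, rfl⟩
        rcases eq_or_ne y z with rfl | hyx
        · exact ⟨x, ⟨hne.symm, hxR⟩, hcx'.symm⟩
        · exact ⟨y, ⟨hyx, hy2⟩, rfl⟩

/-- **Scarf's lemma**: there is a dominant set whose elements carry every colour once. -/
theorem exists_isDominant_image_eq_univ (hr : ∀ i, Function.Injective (r i))
    (hmin : ∀ i x, r i (s i) ≤ r i x)
    (htop : ∀ i j, j ≠ i → ∀ x ∉ Set.range s, r i x < r i (s j)) {t : X}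
    (hts : t ∉ Set.range s) [Nonempty I] {c : X → I} (hc : ∀ i, c (s i) = i) :
    ∃ R : Finset X, IsDominant r R ∧ R.card = Fintype.card I ∧ R.image c = Finset.univ := by
  classical
  by_contra! hno
  obtain ⟨i₀⟩ := ‹Nonempty I›
  have hs : Function.Injective s := fun i j h => by rw [← hc i, ← hc j, h]
  -- Incidences between doors and rooms are counted twice. Without a fully coloured room, each room
  -- has an even number of doors. Each door lies in two rooms, except `D₀`, which lies in one, so
  -- the total is both even and odd.
  set rooms : Finset (Finset X) := Finset.univ.filter fun R =>
    IsDominant r R ∧ R.card = Fintype.card I with hrooms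
  set doors : Finset (Finset X) := Finset.univ.filter fun D =>
    IsDominant r D ∧ D.card + 1 = Fintype.card I ∧ D.image c = Finset.univ.erase i₀ with hdoors
  have hcount := Finset.sum_card_bipartiteAbove_eq_sum_card_bipartiteBelow
    (s := doors) (t := rooms) (fun D R => D ⊆ R)
  have hroom : ∀ R ∈ rooms, Even (doors.bipartiteBelow (fun D R => D ⊆ R) R).card := by
    intro R hR
    obtain ⟨hRd, hRc⟩ := (Finset.mem_filter.mp hR).2
    convert even_card_filter_image_erase hRc (hno R hRd hRc) i₀ using 1
    symm
    apply Finset.card_bij (fun x _ => R.erase x)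
    · intro x hx
      obtain ⟨hxR, hx⟩ := Finset.mem_filter.mp hx
      have := Finset.card_erase_add_one hxR
      simp only [Finset.bipartiteBelow, hdoors, Finset.mem_filter, Finset.mem_univ, true_and]
      exact ⟨⟨hRd.mono (Finset.erase_subset _ _), this.trans hRc, hx⟩, Finset.erase_subset _ _⟩
    · intro x hx y hy h
      have hxR := (Finset.mem_filter.mp hx).1
      by_contra hxy
      have : x ∈ R.erase y := Finset.mem_erase.mpr ⟨hxy, hxR⟩
      rw [← h] at this
      exact Finset.notMem_erase _ _ this
    · intro D hD
      simp only [Finset.bipartiteBelow, hdoors, Finset.mem_filter, Finset.mem_univ,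
        true_and] at hD
      obtain ⟨⟨hDd, hDc, hDi⟩, hDR⟩ := hD
      obtain ⟨x, hx, hxD⟩ : ∃ x ∉ D, insert x D = R := by
        have := Finset.covBy_iff_card_sdiff_eq_one (s := R) (t := D)
        rw [Finset.covBy_iff_exists_insert, Finset.card_sdiff_of_subset hDR] at this
        exact this.mpr ⟨hDR, by omega⟩
      subst hxD
      refine ⟨x, Finset.mem_filter.mpr ⟨Finset.mem_insert_self _ _, ?_⟩, ?_⟩ <;>
        rw [Finset.erase_insert hx]
      exact hDi
  have hdoor : ∀ D ∈ doors, (rooms.bipartiteAbove (fun D R => D ⊆ R) D).card =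
      (Finset.univ.filter fun x => x ∉ D ∧ IsDominant r (insert x D)).card := by
    intro D hD
    obtain ⟨hDd, hDc, hDi⟩ := (Finset.mem_filter.mp hD).2
    symm
    apply Finset.card_bij (fun x _ => insert x D)
    · intro x hx
      obtain ⟨hxD, hx⟩ := (Finset.mem_filter.mp hx).2
      simp only [Finset.bipartiteAbove, hrooms, Finset.mem_filter, Finset.mem_univ, true_and]
      exact ⟨⟨hx, by rw [Finset.card_insert_of_notMem hxD, hDc]⟩, Finset.subset_insert _ _⟩
    · intro x hx y hy h
      have hxD := (Finset.mem_filter.mp hx).2.1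
      have : x ∈ insert y D := h ▸ Finset.mem_insert_self _ _
      exact (Finset.mem_insert.mp this).resolve_right hxD
    · intro R hR
      simp only [Finset.bipartiteAbove, hrooms, Finset.mem_filter, Finset.mem_univ,
        true_and] at hR
      obtain ⟨⟨hRd, hRc⟩, hDR⟩ := hR
      obtain ⟨x, hx, hxD⟩ : ∃ x ∉ D, insert x D = R := by
        have := Finset.covBy_iff_card_sdiff_eq_one (s := R) (t := D)
        rw [Finset.covBy_iff_exists_insert, Finset.card_sdiff_of_subset hDR] at this
        exact this.mpr ⟨hDR, by omega⟩
      subst hxD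
      exact ⟨x, Finset.mem_filter.mpr ⟨Finset.mem_univ _, hx, hRd⟩, rfl⟩
  set D₀ : Finset X := (Finset.univ.erase i₀).image s with hD₀
  have hone := card_insert_slack_eq_one hr hmin htop hts i₀
  have hD₀mem : D₀ ∈ doors := by
    obtain ⟨x, hx⟩ := Finset.card_pos.mp (hone ▸ one_pos)
    refine Finset.mem_filter.mpr ⟨Finset.mem_univ _,
      (Finset.mem_filter.mp hx).2.2.mono (Finset.subset_insert _ _), ?_, ?_⟩
    · rw [Finset.card_image_of_injective _ hs, Finset.card_erase_add_one (Finset.mem_univ _),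
        Finset.card_univ]
    · rw [hD₀, Finset.image_image]
      conv_rhs => rw [← Finset.image_id (s := Finset.univ.erase i₀)]
      exact Finset.image_congr fun i _ => hc i
  have htwo : ∀ D ∈ doors.erase D₀,
      Even (rooms.bipartiteAbove (fun D R => D ⊆ R) D).card := by
    intro D hD
    obtain ⟨hne, hD⟩ := Finset.mem_erase.mp hD
    rw [hdoor D hD]
    obtain ⟨hDd, hDc, hDi⟩ := (Finset.mem_filter.mp hD).2
    by_cases h : ∃ t ∈ D, t ∉ Set.range s
    · obtain ⟨t, ht, hts⟩ := h
      rw [hDd.card_insert_eq_two hr hs hmin htop hDc ht hts]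
      exact even_two
    -- A door of slack elements only is determined by its colours, so it is `D₀`.
    · push Not at h
      refine absurd ?_ hne
      rw [hD₀, ← hDi, Finset.image_image]
      conv_lhs => rw [← Finset.image_id (s := D)]
      refine Finset.image_congr fun x hx => ?_
      obtain ⟨k, rfl⟩ := h x hx
      simp [hc]
  rw [← Finset.add_sum_erase _ _ hD₀mem, hdoor D₀ hD₀mem, hone] at hcount
  have h1 := Finset.even_sum _ htwo
  have h2 := Finset.even_sum _ hroom
  rw [← hcount] at h2
  exact absurd h1 (by simpa [Nat.even_add, parity_simps] using h2)

end Scarf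

/-! ### A covering theorem for the simplex -/

/-- Scarf's lemma for a finite family of integer points: given a colouring of the points by the
coordinates, there are a set `C` of coordinates and points `p k` of colour `k ∈ C` such that no
point exceeds, in all coordinates of `C`, the coordinatewise minimum of the `p k`. -/
theorem exists_colorful_dominant_family {T I : Type*} [Finite T] [Nonempty T] [Finite I]
    [Nonempty I] (h : T → I → ℕ) (c : T → I) :
    ∃ (C : Set I) (p : I → T), C.Nonempty ∧ (∀ k ∈ C, c (p k) = k) ∧
      ∀ t, ∃ i ∈ C, ∀ k ∈ C, h t i ≤ h (p k) i := by
  classical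
  have := Fintype.ofFinite T
  have := Fintype.ofFinite I
  obtain ⟨t₀⟩ := ‹Nonempty T›
  obtain ⟨B, hB⟩ : ∃ B, ∀ t i, h t i < B := by
    obtain ⟨B, hB⟩ := (Set.finite_range fun q : T × I => h q.1 q.2).bddAbove
    exact ⟨B + 1, fun t i => Nat.lt_succ_of_le (hB ⟨(t, i), rfl⟩)⟩
  -- The shift by one puts the slack element of `i` strictly below all points in coordinate `i`, and
  -- `B + 1` puts the others strictly above. An enumeration of `T ⊕ I` then breaks ties in `r`.
  let w : I → T ⊕ I → ℕ := fun i =>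
    Sum.elim (fun t => h t i + 1) fun j => if j = i then 0 else B + 1
  let r : I → T ⊕ I → ℕ ×ₗ Fin (Fintype.card (T ⊕ I)) := fun i x =>
    toLex (w i x, Fintype.equivFin _ x)
  have hlt : ∀ i x y, w i x < w i y → r i x < r i y := fun i x y hxy =>
    Prod.Lex.toLex_lt_toLex.mpr (Or.inl hxy)
  have hle : ∀ i x y, r i x ≤ r i y → w i x ≤ w i y := fun i x y hxy =>
    not_lt.mp fun h' => absurd hxy (not_le.mpr (hlt i y x h'))
  have hr : ∀ i, Function.Injective (r i) := by
    intro i x y hxy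
    have : (w i x, Fintype.equivFin _ x) = (w i y, Fintype.equivFin _ y) := toLex.injective hxy
    exact (Fintype.equivFin _).injective (Prod.ext_iff.mp this).2
  have hmin : ∀ i x, r i (Sum.inr i) ≤ r i x := by
    intro i x
    rcases eq_or_ne x (Sum.inr i) with rfl | hx
    · exact le_rfl
    · refine (hlt _ _ _ ?_).le
      rcases x with t | j
      · simp [w]
      · have : j ≠ i := fun h' => hx (h' ▸ rfl)
        simp [w, this]
  have htop : ∀ i j, j ≠ i → ∀ x ∉ Set.range (Sum.inr : I → T ⊕ I),
      r i x < r i (Sum.inr j) := by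
    intro i j hj x hx
    rcases x with t | k
    · refine hlt _ _ _ ?_
      simp [w, hj, hB]
    · exact absurd ⟨k, rfl⟩ hx
  obtain ⟨R, hR, -, hRc⟩ := exists_isDominant_image_eq_univ hr hmin htop
    (t := Sum.inl t₀) (by simp) (c := Sum.elim c id) fun i => rfl
  have hcol : ∀ i, ∃ t, Sum.inr i ∉ R → Sum.inl t ∈ R ∧ c t = i := by
    intro i
    obtain ⟨x, hx, hxi⟩ := Finset.mem_image.mp (hRc ▸ Finset.mem_univ i)
    rcases x with t | j
    · exact ⟨t, fun _ => ⟨hx, hxi⟩⟩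
    · have hji : j = i := hxi
      exact ⟨t₀, fun h' => absurd (hji ▸ hx) h'⟩
  choose p hp using hcol
  have hdom : ∀ t, ∃ i, Sum.inr i ∉ R ∧ ∀ k, Sum.inr k ∉ R → h t i ≤ h (p k) i := by
    intro t
    obtain ⟨i, hi⟩ := hR (Sum.inl t)
    refine ⟨i, fun hiR => ?_, fun k hk => ?_⟩
    · have := hle _ _ _ (hi _ hiR)
      simp [w] at this
    · have := hle _ _ _ (hi _ (hp k hk).1)
      simpa [w] using this
  refine ⟨{i | Sum.inr i ∉ R}, p, ?_, fun k hk => (hp k hk).2, hdom⟩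
  obtain ⟨i, hi, -⟩ := hdom t₀
  exact ⟨i, hi⟩

/-- Approximate covering theorem on the grid of mesh `1 / N`. -/
theorem exists_stdSimplex_forall_le_or_dist_le {I : Type*} [Fintype I] [Nonempty I]
    {F : I → Set (I → ℝ)} (hcover : ∀ x ∈ stdSimplex ℝ I, ∃ i, x ∈ F i) {N : ℕ} (hN : 0 < N) :
    ∃ x ∈ stdSimplex ℝ I, ∀ i, x i ≤ (Fintype.card I : ℝ) / N ∨
      ∃ y ∈ F i, dist y x ≤ (Fintype.card I : ℝ) / N := by
  classical
  have hN' : (0 : ℝ) < N := Nat.cast_pos.mpr hN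
  let T := {t : I → ℕ // ∑ i, t i = N}
  have hinj : Function.Injective fun (t : T) (i : I) =>
      (⟨t.1 i, Nat.lt_succ_of_le ((Finset.single_le_sum (fun _ _ => Nat.zero_le _)
        (Finset.mem_univ i)).trans_eq t.2)⟩ : Fin (N + 1)) := fun s t h =>
    Subtype.ext (funext fun i => congrArg Fin.val (congrFun h i))
  have : Finite T := Finite.of_injective _ hinj
  have : Nonempty T := ⟨⟨Pi.single (Classical.arbitrary I) N, by simp⟩⟩
  let z : T → I → ℝ := fun t i => (t.1 i : ℝ) / N
  have hz : ∀ t, z t ∈ stdSimplex ℝ I := fun t => by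
    refine ⟨fun i => by positivity, ?_⟩
    rw [← Finset.sum_div, ← Nat.cast_sum, t.2, div_self hN'.ne']
  choose c hc using fun t => hcover (z t) (hz t)
  obtain ⟨C, p, ⟨k₀, hk₀⟩, hpc, hdom⟩ := exists_colorful_dominant_family (fun t : T => t.1) c
  have hm : ∀ i, ∃ v, (∀ k ∈ C, v ≤ (p k).1 i) ∧ (i ∈ C → ∃ k ∈ C, (p k).1 i = v) ∧
      (i ∉ C → v = 0) := by
    intro i
    by_cases hi : i ∈ C
    · obtain ⟨k, hk, hkm⟩ := Set.exists_min_image C (fun k => (p k).1 i) C.toFinite ⟨k₀, hk₀⟩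
      exact ⟨(p k).1 i, hkm, fun _ => ⟨k, hk, rfl⟩, fun h => absurd hi h⟩
    · exact ⟨0, fun _ _ => Nat.zero_le _, fun h => absurd h hi, fun _ => rfl⟩
  choose m hmle hmem hmzero using hm
  -- Otherwise, raising every `m i` by one and giving the remaining mass to `k₀` yields a grid point
  -- above all minima on `C`.
  have hsum : N < ∑ i, (m i + 1) := by
    by_contra! hle
    let t : T := ⟨fun i => m i + 1 + (Pi.single k₀ (N - ∑ i, (m i + 1)) : I → ℕ) i, by
      rw [Finset.sum_add_distrib, Finset.sum_pi_single']
      simpa using Nat.add_sub_of_le hle⟩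
    obtain ⟨i, hi, hit⟩ := hdom t
    obtain ⟨k, hk, hkm⟩ := hmem i hi
    have h1 : m i + 1 + _ ≤ (p k).1 i := hit k hk
    omega
  -- The excesses of `p k` over `m` are nonnegative and sum to `N - ∑ i, m i`, which is less than
  -- `Fintype.card I`.
  have hclose : ∀ k ∈ C, ∀ i, (p k).1 i ≤ m i + Fintype.card I := by
    intro k hk i
    have h1 : ∑ j, ((p k).1 j - m j) + ∑ j, m j = N := by
      rw [← Finset.sum_add_distrib]
      refine Eq.trans ?_ (p k).2
      exact Finset.sum_congr rfl fun j _ => Nat.sub_add_cancel (hmle j k hk)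
    have h2 : (p k).1 i - m i ≤ ∑ j, ((p k).1 j - m j) :=
      Finset.single_le_sum (f := fun j => (p k).1 j - m j) (fun _ _ => Nat.zero_le _)
        (Finset.mem_univ i)
    rw [Finset.sum_add_distrib] at hsum
    simp only [Finset.sum_const, Finset.card_univ, smul_eq_mul, mul_one] at hsum
    omega
  refine ⟨z (p k₀), hz _, fun i => ?_⟩
  by_cases hi : i ∈ C
  · refine Or.inr ⟨z (p i), by simpa [hpc i hi] using hc (p i), ?_⟩
    refine (dist_pi_le_iff (by positivity)).mpr fun j => ?_
    rw [Real.dist_eq, ← sub_div, abs_div, abs_of_pos hN']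
    gcongr
    have h1 := hclose i hi j
    have h2 := hclose k₀ hk₀ j
    have h3 := hmle j i hi
    have h4 := hmle j k₀ hk₀
    rw [abs_le]
    constructor
    · have : (p k₀).1 j ≤ (p i).1 j + Fintype.card I := by omega
      have : ((p k₀).1 j : ℝ) ≤ (p i).1 j + Fintype.card I := by exact_mod_cast this
      linarith
    · have : (p i).1 j ≤ (p k₀).1 j + Fintype.card I := by omega
      have : ((p i).1 j : ℝ) ≤ (p k₀).1 j + Fintype.card I := by exact_mod_cast this
      linarith
  · left
    have h1 := hclose k₀ hk₀ i
    rw [hmzero i hi, zero_add] at h1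
    have : ((p k₀).1 i : ℝ) ≤ Fintype.card I := by exact_mod_cast h1
    exact div_le_div_of_nonneg_right this hN'.le

/-- If finitely many closed sets, indexed by the vertices, cover the standard simplex, then some
point of the simplex lies in all the sets indexed by the vertices of its support. -/
theorem exists_stdSimplex_forall_pos_imp_mem {I : Type*} [Fintype I] [Nonempty I]
    {F : I → Set (I → ℝ)} (hF : ∀ i, IsClosed (F i))
    (hcover : ∀ x ∈ stdSimplex ℝ I, ∃ i, x ∈ F i) :
    ∃ x ∈ stdSimplex ℝ I, ∀ i, 0 < x i → x ∈ F i := by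
  choose z hz hzF using fun n : ℕ =>
    exists_stdSimplex_forall_le_or_dist_le hcover (Nat.succ_pos n)
  obtain ⟨x, hx, φ, hφ, hlim⟩ := (isCompact_stdSimplex ℝ I).tendsto_subseq hz
  refine ⟨x, hx, fun i hi => ?_⟩
  rw [← (hF i).closure_eq, Metric.mem_closure_iff]
  intro ε hε
  have hmesh : Filter.Tendsto (fun n => (Fintype.card I : ℝ) / ((φ n).succ : ℕ))
      Filter.atTop (𝓝 0) :=
    (tendsto_const_div_atTop_nhds_zero_nat (Fintype.card I : ℝ)).comp
      ((Filter.tendsto_add_atTop_nat 1).comp hφ.tendsto_atTop)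
  have hxi : Filter.Tendsto (fun n => z (φ n) i) Filter.atTop (𝓝 (x i)) :=
    ((continuous_apply i).tendsto x).comp hlim
  -- Since `x i > 0`, the mesh bound eventually drops below `z (φ n) i`, which rules out the first
  -- alternative.
  obtain ⟨n, hn1, hn2, hn3⟩ := ((hmesh.eventually_lt hxi hi).and
    ((hmesh.eventually_lt_const (half_pos hε)).and
      (Metric.tendsto_nhds.mp hlim _ (half_pos hε)))).exists
  rcases hzF (φ n) i with h | ⟨y, hy, hyd⟩
  · exact absurd hn1 (not_lt.mpr h)
  · refine ⟨y, hy, ?_⟩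
    have h1 := dist_triangle_right x y (z (φ n))
    rw [Function.comp_apply, dist_comm] at hn3
    linarith

/-! ### Ky Fan's inequality and Nash equilibria of concave games -/

/-- **Ky Fan's inequality** on the convex hull of finitely many points. -/
theorem exists_mem_forall_le_of_finite {E J : Type*} [AddCommGroup E] [Module ℝ E]
    [TopologicalSpace E] [ContinuousAdd E] [ContinuousSMul ℝ E] [Finite J] [Nonempty J]
    {K : Set E} (hK : Convex ℝ K) {Φ : E → E → ℝ} (hcont : ∀ y ∈ K, ContinuousOn (Φ · y) K)
    (hconc : ∀ x ∈ K, ConcaveOn ℝ K (Φ x)) (hdiag : ∀ x ∈ K, Φ x x ≤ 0)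
    {y : J → E} (hy : ∀ j, y j ∈ K) : ∃ x ∈ K, ∀ j, Φ x (y j) ≤ 0 := by
  have := Fintype.ofFinite J
  let τ : (J → ℝ) → E := fun w => ∑ j, w j • y j
  have hτ : Continuous τ := by fun_prop
  have hτK : ∀ w ∈ stdSimplex ℝ J, τ w ∈ K := fun w hw =>
    hK.sum_mem (fun j _ => hw.1 j) hw.2 fun j _ => hy j
  have hΦ : ∀ j, ContinuousOn (fun w => Φ (τ w) (y j)) (stdSimplex ℝ J) := fun j =>
    (hcont _ (hy j)).comp hτ.continuousOn hτK
  -- The `j`-th set collects the weights for which `y j` maximizes `Φ (τ w)` among the test points.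
  -- At the `w` obtained, every `y j` of positive weight is a maximizer, so the maximum is the
  -- weighted mean, bounded by `Φ (τ w) (τ w)` through concavity.
  obtain ⟨w, hw, hwF⟩ := exists_stdSimplex_forall_pos_imp_mem
    (F := fun j => ⋂ k, {w | w ∈ stdSimplex ℝ J ∧ Φ (τ w) (y k) ≤ Φ (τ w) (y j)})
    (fun j => isClosed_iInter fun k =>
      (isClosed_stdSimplex ℝ J).isClosed_le (hΦ k) (hΦ j))
    (fun w hw => by
      obtain ⟨j, hj⟩ := Finite.exists_max fun j => Φ (τ w) (y j)
      exact ⟨j, Set.mem_iInter.mpr fun k => ⟨hw, hj k⟩⟩)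
  refine ⟨τ w, hτK w hw, fun k => ?_⟩
  have hle : ∀ j, w j * Φ (τ w) (y k) ≤ w j * Φ (τ w) (y j) := fun j => by
    rcases (hw.1 j).eq_or_lt with h | h
    · rw [← h]; simp
    · exact mul_le_mul_of_nonneg_left (Set.mem_iInter.mp (hwF j h) k).2 h.le
  calc Φ (τ w) (y k) = ∑ j, w j * Φ (τ w) (y k) := by
        rw [← Finset.sum_mul, hw.2, one_mul]
    _ ≤ ∑ j, w j * Φ (τ w) (y j) := Finset.sum_le_sum fun j _ => hle j
    _ ≤ Φ (τ w) (τ w) :=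
        (hconc _ (hτK w hw)).le_map_sum (fun j _ => hw.1 j) hw.2 fun j _ => hy j
    _ ≤ 0 := hdiag _ (hτK w hw)

/-- **Ky Fan's inequality**. -/
theorem exists_mem_forall_le_zero {E : Type*} [AddCommGroup E] [Module ℝ E]
    [TopologicalSpace E] [T2Space E] [ContinuousAdd E] [ContinuousSMul ℝ E]
    {K : Set E} (hKc : IsCompact K) (hK : Convex ℝ K) (hne : K.Nonempty) {Φ : E → E → ℝ}
    (hcont : ∀ y ∈ K, ContinuousOn (Φ · y) K) (hconc : ∀ x ∈ K, ConcaveOn ℝ K (Φ x))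
    (hdiag : ∀ x ∈ K, Φ x x ≤ 0) : ∃ x ∈ K, ∀ y ∈ K, Φ x y ≤ 0 := by
  obtain ⟨x, hx, hxK⟩ := hKc.inter_iInter_nonempty
    (fun y : K => {x | x ∈ K ∧ Φ x y ≤ 0})
    (fun y => hKc.isClosed.isClosed_le (hcont _ y.2) continuousOn_const) fun u => by
      rcases u.eq_empty_or_nonempty with rfl | hu
      · simpa using hne
      · have : Nonempty u := hu.to_subtype
        obtain ⟨x, hx, hxu⟩ := exists_mem_forall_le_of_finite hK hcont hconc hdiag
          (y := fun j : u => (j.1 : E)) fun j => j.1.2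
        exact ⟨x, hx, Set.mem_iInter₂.mpr fun j hj => ⟨hx, hxu ⟨j, hj⟩⟩⟩
  exact ⟨x, hx, fun y hy => (Set.mem_iInter.mp hxK ⟨y, hy⟩).2⟩

/-- A concave game with finitely many players has a Nash equilibrium. -/
theorem StrategicGame.IsConcaveGame.exists_isNash {ι : Type*} [Fintype ι] [DecidableEq ι]
    {E : ι → Type*} [∀ i, AddCommGroup (E i)] [∀ i, Module ℝ (E i)]
    [∀ i, TopologicalSpace (E i)] [∀ i, T2Space (E i)] [∀ i, ContinuousAdd (E i)]
    [∀ i, ContinuousSMul ℝ (E i)] {G : StrategicGame ι E} (hG : G.IsConcaveGame) :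
    ∃ x, G.IsNash x := by
  have hupd : ∀ x ∈ Set.univ.pi G.strategies, ∀ i, ∀ y ∈ G.strategies i,
      Function.update x i y ∈ Set.univ.pi G.strategies := fun x hx i y hy =>
    Set.update_mem_pi_iff_of_mem hx |>.mpr fun _ => hy
  -- Testing against a profile that differs from `x` for one player leaves only that player's gain
  -- in the sum.
  suffices h : ∃ x ∈ Set.univ.pi G.strategies, ∀ y ∈ Set.univ.pi G.strategies,
      ∑ i, (G.payoff i (Function.update x i (y i)) - G.payoff i x) ≤ 0 by
    obtain ⟨x, hx, hxK⟩ := h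
    refine ⟨x, fun i => hx i (Set.mem_univ i), fun i y hy => ?_⟩
    have h := hxK _ (hupd x hx i y hy)
    rw [Finset.sum_eq_single i] at h
    · simpa using h
    · intro j _ hj
      simp [hj]
    · simp
  refine exists_mem_forall_le_zero
    (Φ := fun x y => ∑ i, (G.payoff i (Function.update x i (y i)) - G.payoff i x))
    (isCompact_univ_pi hG.compact) (convex_pi fun i _ => hG.convex i)
    (Set.univ_pi_nonempty_iff.mpr hG.nonempty) ?_ ?_ ?_
  · intro y hy
    refine continuousOn_finsetSum _ fun i _ => ?_
    refine ContinuousOn.sub ?_ (hG.continuous_payoff i)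
    exact (hG.continuous_payoff i).comp
      (continuous_id.update i continuous_const).continuousOn
      fun x hx => hupd x hx i _ (hy i (Set.mem_univ i))
  · intro x hx
    refine ⟨convex_pi fun i _ => hG.convex i, fun y hy z hz a b ha hb hab => ?_⟩
    rw [Finset.smul_sum, Finset.smul_sum, ← Finset.sum_add_distrib]
    refine Finset.sum_le_sum fun i _ => ?_
    have h := (hG.concave_payoff i x hx).2 (hy i (Set.mem_univ i)) (hz i (Set.mem_univ i))
      ha hb hab
    simp only [smul_eq_mul, Pi.add_apply, Pi.smul_apply] at h ⊢
    have h2 : (a + b) * G.payoff i x = G.payoff i x := by rw [hab, one_mul]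
    linarith
  · intro x _
    simp

/-! ### Expected utility and the perturbed game -/

section Multilinear

variable {ι : Type*} [Fintype ι] [DecidableEq ι] {A : ι → Type*} [∀ i, Fintype (A i)]

theorem contDiff_expectedUtility (v : (∀ i, A i) → ℝ) {n : WithTop ℕ∞} :
    ContDiff ℝ n (expectedUtility v) := by
  unfold expectedUtility
  exact ContDiff.sum fun a _ => (contDiff_prod fun j _ =>
    contDiff_pi.mp (contDiff_pi.mp contDiff_id j) (a j)).mul contDiff_const

/-- Every product of probabilities has exactly one factor belonging to player `i`, so expected
utility is linear in that player's strategy. -/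
theorem expectedUtility_update_combination (v : (∀ i, A i) → ℝ) (x : ∀ i, A i → ℝ) (i : ι)
    (y z : A i → ℝ) (a b : ℝ) :
    expectedUtility v (Function.update x i (a • y + b • z)) =
      a * expectedUtility v (Function.update x i y) +
        b * expectedUtility v (Function.update x i z) := by
  have h : ∀ (w : A i → ℝ) (c : ∀ i, A i), ∏ j, Function.update x i w j (c j) =
      w (c i) * ∏ j ∈ Finset.univ.erase i, x j (c j) := fun w c => by
    rw [← Finset.mul_prod_erase _ _ (Finset.mem_univ i), Function.update_self]
    congr 1
    exact Finset.prod_congr rfl fun j hj => by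
      rw [Function.update_of_ne (Finset.ne_of_mem_erase hj)]
  simp only [expectedUtility, h, Finset.mul_sum, ← Finset.sum_add_distrib, Pi.add_apply,
    Pi.smul_apply, smul_eq_mul]
  exact Finset.sum_congr rfl fun c _ => by ring

variable (u : ι → (∀ i, A i) → ℝ) (lam : ι → ℝ) (f : ∀ i, (A i → ℝ) → ℝ)

theorem isGQRE_iff_isNash (π : ∀ i, A i → ℝ) :
    IsGQRE u lam f π ↔ (perturbedGame u lam f).IsNash π := by
  simp only [IsGQRE, gqreCorrespondence, generalizedQuantalResponse, Set.mem_ofPred_eq,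
    StrategicGame.IsNash, perturbedGame, isMaxOn_iff, Function.update_self,
    Function.update_eq_self, forall_and]

theorem isConcaveGame_perturbedGame [∀ i, Nonempty (A i)]
    (hcont : ∀ i, ContinuousOn (f i) (stdSimplex ℝ (A i)))
    (hconv : ∀ i, ConvexOn ℝ (stdSimplex ℝ (A i)) (f i)) :
    (perturbedGame u lam f).IsConcaveGame where
  nonempty i := by
    classical
    exact ⟨_, single_mem_stdSimplex ℝ (Classical.arbitrary (A i))⟩
  compact i := isCompact_stdSimplex ℝ (A i)
  convex i := convex_stdSimplex ℝ (A i)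
  continuous_payoff i := by
    refine ContinuousOn.sub
      ((contDiff_expectedUtility (n := 0) (u i)).continuous.const_mul (lam i)).continuousOn ?_
    exact (hcont i).comp (continuous_apply i).continuousOn fun x hx => hx i (Set.mem_univ i)
  concave_payoff i x _ := by
    refine ⟨convex_stdSimplex ℝ (A i), fun y hy z hz a b ha hb hab => ?_⟩
    have h := (hconv i).2 hy hz ha hb hab
    simp only [perturbedGame, Function.update_self, expectedUtility_update_combination,
      smul_eq_mul] at h ⊢
    linarith

end Multilinear

/-! ### Twice differentiable functions -/

section TwiceDifferentiable

variable {E F : Type*} [NormedAddCommGroup E] [NormedSpace ℝ E] [NormedAddCommGroup F]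
  [NormedSpace ℝ F] {f g : E → ℝ} {x : E}

theorem TwiceDifferentiableAt.differentiableAt (hf : TwiceDifferentiableAt f x) :
    DifferentiableAt ℝ f x :=
  hf.1.self_of_nhds

theorem ContDiff.twiceDifferentiableAt (hf : ContDiff ℝ 2 f) (x : E) :
    TwiceDifferentiableAt f x :=
  ⟨.of_forall fun _ => (hf.differentiable (by norm_num)).differentiableAt,
    ((hf.fderiv_right (m := 1) (by norm_num)).differentiable one_ne_zero).differentiableAt⟩

theorem TwiceDifferentiableAt.sub (hf : TwiceDifferentiableAt f x)
    (hg : TwiceDifferentiableAt g x) : TwiceDifferentiableAt (fun y => f y - g y) x := by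
  refine ⟨(hf.1.and hg.1).mono fun y hy => hy.1.sub hy.2,
    (hf.2.sub hg.2).congr_of_eventuallyEq ?_⟩
  exact (hf.1.and hg.1).mono fun y hy => fderiv_sub hy.1 hy.2

theorem TwiceDifferentiableAt.comp_continuousLinearMap {f : F → ℝ} {T : E →L[ℝ] F}
    (hf : TwiceDifferentiableAt f (T x)) : TwiceDifferentiableAt (fun y => f (T y)) x := by
  have hev : ∀ᶠ y in 𝓝 x, DifferentiableAt ℝ f (T y) :=
    (T.continuous.tendsto x).eventually hf.1
  have h2 : DifferentiableAt ℝ (fun y => (fderiv ℝ f (T y)).comp T) x :=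
    (hf.2.comp x T.differentiableAt).clm_comp (differentiableAt_const T)
  refine ⟨hev.mono fun y hy => hy.comp y T.differentiableAt, h2.congr_of_eventuallyEq ?_⟩
  refine hev.mono fun y hy => ?_
  exact (hy.hasFDerivAt.comp y T.hasFDerivAt).fderiv

theorem TwiceDifferentiableAt.hasFDerivAt_fderiv_apply (hf : TwiceDifferentiableAt f x) (v : E) :
    HasFDerivAt (fun y => fderiv ℝ f y v) ((fderiv ℝ (fderiv ℝ f) x).flip v) x := by
  simpa using hf.2.hasFDerivAt.clm_apply (hasFDerivAt_const v x)

/-- A function whose second derivative is nonpositive on a segment, in its direction, is concave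
along it. -/
theorem le_combination_of_fderiv_fderiv_nonpos {y : E}
    (hf : ∀ z ∈ segment ℝ x y, TwiceDifferentiableAt f z)
    (hneg : ∀ z ∈ segment ℝ x y, fderiv ℝ (fderiv ℝ f) z (y - x) (y - x) ≤ 0) {a b : ℝ}
    (ha : 0 ≤ a) (hb : 0 ≤ b) (hab : a + b = 1) : a * f x + b * f y ≤ f (a • x + b • y) := by
  let γ : ℝ → E := fun t => AffineMap.lineMap x y t
  have hγ : ∀ t, HasDerivAt γ (y - x) t := fun t => AffineMap.hasDerivAt_lineMap
  have hmem : ∀ t ∈ Set.Icc (0 : ℝ) 1, γ t ∈ segment ℝ x y := fun t ht => by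
    rw [segment_eq_image_lineMap]
    exact ⟨t, ht, rfl⟩
  have hconc : ConcaveOn ℝ (Set.Icc (0 : ℝ) 1) fun t => f (γ t) := by
    refine concaveOn_of_hasDerivWithinAt2_nonpos (convex_Icc 0 1)
      (f' := fun t => fderiv ℝ f (γ t) (y - x))
      (f'' := fun t => fderiv ℝ (fderiv ℝ f) (γ t) (y - x) (y - x)) ?_ ?_ ?_ ?_
    · exact fun t ht => ((hf _ (hmem t ht)).differentiableAt.continuousAt.comp
        (hγ t).continuousAt).continuousWithinAt
    · exact fun t ht => ((hf _ (hmem t (interior_subset ht))).differentiableAt.hasFDerivAt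
        |>.comp_hasDerivAt t (hγ t)).hasDerivWithinAt
    · exact fun t ht => (((hf _ (hmem t (interior_subset ht))).hasFDerivAt_fderiv_apply (y - x))
        |>.comp_hasDerivAt t (hγ t)).hasDerivWithinAt
    · exact fun t ht => hneg _ (hmem t (interior_subset ht))
  have h := hconc.2 (Set.left_mem_Icc.mpr zero_le_one) (Set.right_mem_Icc.mpr zero_le_one)
    ha hb hab
  have hγab : γ b = a • x + b • y := by
    simp only [γ, AffineMap.lineMap_apply_module, ← hab, add_sub_cancel_right]
  simp only [smul_eq_mul, mul_zero, mul_one, zero_add, hγab] at h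
  simpa only [γ, AffineMap.lineMap_apply_zero, AffineMap.lineMap_apply_one] using h

end TwiceDifferentiable

/-! ### Rosen's uniqueness theorem -/

namespace StrategicGame

variable {ι : Type*} [Fintype ι] [DecidableEq ι] {A : ι → Type*} [∀ i, Fintype (A i)]
  [∀ i, DecidableEq (A i)]

/-- The inner partial derivative is given by `fderiv` on a whole neighbourhood of `π`, so it can be
differentiated again. The outer direction `l` is the first argument of the second derivative. -/
theorem partialDeriv_partialDeriv {g : (∀ i, A i → ℝ) → ℝ} {π : ∀ i, A i → ℝ}
    (hg : TwiceDifferentiableAt g π) (k l : Σ i, A i) :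
    partialDeriv (partialDeriv g k) l π =
      fderiv ℝ (fderiv ℝ g) π (Pi.single l.1 (Pi.single l.2 1))
        (Pi.single k.1 (Pi.single k.2 1)) := by
  have hev : partialDeriv g k =ᶠ[𝓝 π] fun y => fderiv ℝ g y (Pi.single k.1 (Pi.single k.2 1)) :=
    hg.1.mono fun y hy => hy.lineDeriv_eq_fderiv
  have h := hg.hasFDerivAt_fderiv_apply (Pi.single k.1 (Pi.single k.2 1))
  rw [partialDeriv, hev.lineDeriv_eq, h.differentiableAt.lineDeriv_eq_fderiv, h.fderiv,
    ContinuousLinearMap.flip_apply]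

omit [Fintype ι] in
theorem single_eq_sum_smul_single (i : ι) (w : A i → ℝ) :
    (Pi.single i w : ∀ i, A i → ℝ) =
      ∑ a, w a • (Pi.single i (Pi.single a 1) : ∀ i, A i → ℝ) := by
  conv_lhs => rw [pi_eq_sum_univ' w]
  have := map_sum (LinearMap.single ℝ (fun i => A i → ℝ) i)
    (fun a => w a • (Pi.single a 1 : A i → ℝ)) Finset.univ
  simpa only [map_smul, LinearMap.coe_single] using this

/-- The sum is the quadratic form of `gradJacobian` at `v`, which is half that of the symmetrized
matrix. It is also the rate of change, in direction `v`, of the own-payoff gradients paired with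
`v`. -/
theorem sum_fderiv_fderiv_neg {G : StrategicGame ι (fun i => A i → ℝ)}
    (hG : G.StrictDiagonalDominance) {π : ∀ i, A i → ℝ} (hπ : ∀ i, π i ∈ G.strategies i)
    (hdiff : ∀ i, TwiceDifferentiableAt (G.payoff i) π) {v : ∀ i, A i → ℝ} (hv : v ≠ 0) :
    ∑ i, fderiv ℝ (fderiv ℝ (G.payoff i)) π v (Pi.single i (v i)) < 0 := by
  let V : (Σ i, A i) → ℝ := fun k => v k.1 k.2
  have hV : V ≠ 0 := fun h => hv (funext fun i => funext fun a => congrFun h ⟨i, a⟩)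
  have hvsum : v = ∑ l : Σ i, A i, V l • (Pi.single l.1 (Pi.single l.2 1) : ∀ i, A i → ℝ) := by
    rw [Fintype.sum_sigma]
    exact (Finset.univ_sum_single v).symm.trans
      (Finset.sum_congr rfl fun i _ => single_eq_sum_smul_single i (v i))
  have hquad : V ⬝ᵥ (G.gradJacobian π).mulVec V =
      ∑ i, fderiv ℝ (fderiv ℝ (G.payoff i)) π v (Pi.single i (v i)) := by
    simp only [dotProduct, Fintype.sum_sigma]
    refine Finset.sum_congr rfl fun i _ => ?_
    rw [single_eq_sum_smul_single i (v i), map_sum]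
    refine Finset.sum_congr rfl fun a _ => ?_
    rw [map_smul, smul_eq_mul]
    congr 1
    conv_rhs => rw [hvsum]
    rw [map_sum, sum_apply]
    refine Finset.sum_congr rfl fun l _ => ?_
    rw [map_smul, smul_apply, smul_eq_mul, mul_comm]
    congr 1
    exact partialDeriv_partialDeriv (hdiff i) ⟨i, a⟩ l
  have hpos := (hG π hπ).dotProduct_mulVec_pos hV
  rw [star_trivial, Matrix.neg_mulVec, Matrix.add_mulVec, dotProduct_neg, dotProduct_add,
    Matrix.mulVec_transpose, dotProduct_comm V (Matrix.vecMul _ _), ← Matrix.dotProduct_mulVec,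
    hquad] at hpos
  linarith

/-- For a direction supported on player `i`, only the `i`-th diagonal block contributes to the
quadratic form. -/
theorem fderiv_fderiv_single_nonpos {G : StrategicGame ι (fun i => A i → ℝ)}
    (hG : G.StrictDiagonalDominance) {π : ∀ i, A i → ℝ} (hπ : ∀ i, π i ∈ G.strategies i)
    (hdiff : ∀ i, TwiceDifferentiableAt (G.payoff i) π) (i : ι) (w : A i → ℝ) :
    fderiv ℝ (fderiv ℝ (G.payoff i)) π (Pi.single i w) (Pi.single i w) ≤ 0 := by
  rcases eq_or_ne w 0 with rfl | hw
  · simp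
  · have h := sum_fderiv_fderiv_neg hG hπ hdiff (v := Pi.single i w)
      (fun h => hw (by simpa using congrFun h i))
    rw [Finset.sum_eq_single i] at h
    · simpa using h.le
    · intro j _ hj
      simp [hj]
    · simp

/-- A game with compact convex strategy sets and twice differentiable payoffs that satisfies
strict diagonal dominance is a concave game. -/
theorem StrictDiagonalDominance.isConcaveGame {G : StrategicGame ι (fun i => A i → ℝ)}
    (hG : G.StrictDiagonalDominance) (hne : ∀ i, (G.strategies i).Nonempty)
    (hcomp : ∀ i, IsCompact (G.strategies i)) (hconv : ∀ i, Convex ℝ (G.strategies i))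
    (hdiff : ∀ i, ∀ π ∈ Set.univ.pi G.strategies, TwiceDifferentiableAt (G.payoff i) π) :
    G.IsConcaveGame where
  nonempty := hne
  compact := hcomp
  convex := hconv
  continuous_payoff i π hπ := (hdiff i π hπ).differentiableAt.continuousAt.continuousWithinAt
  concave_payoff i x hx := by
    refine ⟨hconv i, fun y hy z hz a b ha hb hab => ?_⟩
    have hupd : ∀ y ∈ G.strategies i, Function.update x i y ∈ Set.univ.pi G.strategies :=
      fun y hy => Set.update_mem_pi_iff_of_mem hx |>.mpr fun _ => hy
    have hseg : segment ℝ (Function.update x i y) (Function.update x i z) ⊆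
        Set.univ.pi G.strategies :=
      (convex_pi fun i _ => hconv i).segment_subset (hupd y hy) (hupd z hz)
    have hsub : Function.update x i z - Function.update x i y = Pi.single i (z - y) := by
      rw [← Function.update_sub, sub_self]; rfl
    have hcomb : a • Function.update x i y + b • Function.update x i z =
        Function.update x i (a • y + b • z) := by
      rw [← Function.update_smul, ← Function.update_smul, ← Function.update_add, ← add_smul, hab,
        one_smul]
    have h := le_combination_of_fderiv_fderiv_nonpos
      (fun π hπ => hdiff i π (hseg hπ)) (fun π hπ => by
        rw [hsub]
        exact fderiv_fderiv_single_nonpos hG (fun j => hseg hπ j (Set.mem_univ j))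
          (fun j => hdiff j π (hseg hπ)) i (z - y)) ha hb hab
    rw [hcomb] at h
    exact h

omit [∀ i, DecidableEq (A i)] in
/-- The first-order condition at a Nash equilibrium. -/
theorem IsNash.fderiv_single_sub_nonpos {G : StrategicGame ι (fun i => A i → ℝ)}
    {x : ∀ i, A i → ℝ} (hx : G.IsNash x) {i : ι} (hconv : Convex ℝ (G.strategies i))
    (hdiff : DifferentiableAt ℝ (G.payoff i) x) {y : A i → ℝ} (hy : y ∈ G.strategies i) :
    fderiv ℝ (G.payoff i) x (Pi.single i (y - x i)) ≤ 0 := by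
  have hmax : IsMaxOn (G.payoff i) (Function.update x i '' G.strategies i) x := by
    rintro _ ⟨z, hz, rfl⟩
    exact hx.2 i z hz
  refine hmax.localize.hasFDerivWithinAt_nonpos hdiff.hasFDerivAt.hasFDerivWithinAt
    (mem_posTangentConeAt_of_segment_subset ?_)
  rintro _ ⟨a, b, ha, hb, hab, rfl⟩
  refine ⟨a • x i + b • y, hconv (hx.1 i) hy ha hb hab, ?_⟩
  ext1 j
  rcases eq_or_ne j i with rfl | hj
  · obtain rfl := eq_sub_of_add_eq hab
    simp only [Function.update_self, Pi.add_apply, Pi.smul_apply, Pi.single_eq_same]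
    module
  · simp [hj, ← add_smul, hab]

/-- **Rosen's uniqueness theorem**: under strict diagonal dominance there is at most one Nash
equilibrium. -/
theorem StrictDiagonalDominance.isNash_unique {G : StrategicGame ι (fun i => A i → ℝ)}
    (hG : G.StrictDiagonalDominance) (hconv : ∀ i, Convex ℝ (G.strategies i))
    (hdiff : ∀ i, ∀ π ∈ Set.univ.pi G.strategies, TwiceDifferentiableAt (G.payoff i) π)
    {x y : ∀ i, A i → ℝ} (hx : G.IsNash x) (hy : G.IsNash y) : x = y := by
  by_contra hxy
  have hxK : x ∈ Set.univ.pi G.strategies := fun i _ => hx.1 i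
  have hyK : y ∈ Set.univ.pi G.strategies := fun i _ => hy.1 i
  let γ : ℝ → ∀ i, A i → ℝ := fun t => AffineMap.lineMap x y t
  have hγ : ∀ t, HasDerivAt γ (y - x) t := fun t => AffineMap.hasDerivAt_lineMap
  have hmem : ∀ t ∈ Set.Icc (0 : ℝ) 1, γ t ∈ Set.univ.pi G.strategies := fun t ht =>
    (convex_pi fun i _ => hconv i).segment_subset hxK hyK (by
      rw [segment_eq_image_lineMap]
      exact ⟨t, ht, rfl⟩)
  -- The gradient field paired with `y - x` along the segment: strict dominance gives `φ 1 < φ 0`,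
  -- while the equilibrium conditions at `x` and `y` give `φ 0 ≤ 0 ≤ φ 1`.
  let φ : ℝ → ℝ := fun t => ∑ i, fderiv ℝ (G.payoff i) (γ t) (Pi.single i ((y - x) i))
  have hφ : ∀ t ∈ Set.Icc (0 : ℝ) 1, HasDerivAt φ
      (∑ i, fderiv ℝ (fderiv ℝ (G.payoff i)) (γ t) (y - x) (Pi.single i ((y - x) i))) t :=
    fun t ht => HasDerivAt.fun_sum fun i _ =>
      ((hdiff i _ (hmem t ht)).hasFDerivAt_fderiv_apply _).comp_hasDerivAt t (hγ t)
  have hanti : StrictAntiOn φ (Set.Icc 0 1) := by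
    refine strictAntiOn_of_hasDerivWithinAt_neg (convex_Icc 0 1)
      (fun t ht => (hφ t ht).continuousAt.continuousWithinAt)
      (fun t ht => (hφ t (interior_subset ht)).hasDerivWithinAt) fun t ht => ?_
    have ht := hmem t (interior_subset ht)
    exact sum_fderiv_fderiv_neg hG (fun i => ht i (Set.mem_univ i)) (fun i => hdiff i _ ht)
      (sub_ne_zero.mpr (Ne.symm hxy))
  have h01 := hanti (Set.left_mem_Icc.mpr zero_le_one) (Set.right_mem_Icc.mpr zero_le_one)
    zero_lt_one
  have h0 : φ 0 ≤ 0 := Finset.sum_nonpos fun i _ => by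
    simpa [γ] using hx.fderiv_single_sub_nonpos (hconv i) (hdiff i x hxK).differentiableAt
      (hy.1 i)
  have h1 : 0 ≤ φ 1 := Finset.sum_nonneg fun i _ => by
    have h := hy.fderiv_single_sub_nonpos (hconv i) (hdiff i y hyK).differentiableAt (hx.1 i)
    rw [← neg_sub, Pi.single_neg, map_neg] at h
    simpa [γ] using h
  linarith

end StrategicGame

theorem twiceDifferentiableAt_perturbedGame_payoff {ι : Type*} [Fintype ι] [DecidableEq ι]
    {A : ι → Type*} [∀ i, Fintype (A i)] (u : ι → (∀ i, A i) → ℝ) (lam : ι → ℝ)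
    {f : ∀ i, (A i → ℝ) → ℝ} {i : ι} {π : ∀ i, A i → ℝ}
    (hf : TwiceDifferentiableAt (f i) (π i)) :
    TwiceDifferentiableAt ((perturbedGame u lam f).payoff i) π :=
  ((contDiff_const.mul (contDiff_expectedUtility (u i))).twiceDifferentiableAt π).sub
    (TwiceDifferentiableAt.comp_continuousLinearMap
      (T := ContinuousLinearMap.proj (R := ℝ) (φ := fun i => A i → ℝ) i) hf)

theorem theorem1 {ι : Type*} [Fintype ι] [DecidableEq ι] {A : ι → Type*}
    [∀ i, Fintype (A i)] [∀ i, DecidableEq (A i)] [∀ i, Nonempty (A i)]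
    (u : ι → (∀ i, A i) → ℝ) (lam : ι → ℝ) (f : ∀ i, (A i → ℝ) → ℝ) :
    (∀ π : ∀ i, A i → ℝ, IsGQRE u lam f π ↔ (perturbedGame u lam f).IsNash π) ∧
    ((∀ i, ContinuousOn (f i) (stdSimplex ℝ (A i))) →
      (∀ i, ConvexOn ℝ (stdSimplex ℝ (A i)) (f i)) →
        (perturbedGame u lam f).IsConcaveGame ∧ ∃ π : ∀ i, A i → ℝ, IsGQRE u lam f π) ∧
    ((∀ i, ∀ x ∈ stdSimplex ℝ (A i), TwiceDifferentiableAt (f i) x) →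
      (perturbedGame u lam f).StrictDiagonalDominance →
        ∃! π : ∀ i, A i → ℝ, IsGQRE u lam f π) := by
  refine ⟨isGQRE_iff_isNash u lam f, fun hcont hconv => ?_, fun hdiff hG => ?_⟩
  · have h := isConcaveGame_perturbedGame u lam f hcont hconv
    exact ⟨h, h.exists_isNash.imp fun π hπ => (isGQRE_iff_isNash u lam f π).mpr hπ⟩
  · have hpay : ∀ i, ∀ π ∈ Set.univ.pi (perturbedGame u lam f).strategies,
        TwiceDifferentiableAt ((perturbedGame u lam f).payoff i) π := fun i π hπ =>
      twiceDifferentiableAt_perturbedGame_payoff u lam (hdiff i _ (hπ i (Set.mem_univ i)))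
    have hconv : ∀ i, Convex ℝ ((perturbedGame u lam f).strategies i) := fun i =>
      convex_stdSimplex ℝ (A i)
    obtain ⟨π, hπ⟩ := (hG.isConcaveGame
      (fun i => ⟨_, single_mem_stdSimplex ℝ (Classical.arbitrary (A i))⟩)
      (fun i => isCompact_stdSimplex ℝ (A i)) hconv hpay).exists_isNash
    refine ⟨π, (isGQRE_iff_isNash u lam f π).mpr hπ, fun ρ hρ => ?_⟩
    exact hG.isNash_unique hconv hpay ((isGQRE_iff_isNash u lam f ρ).mp hρ) hπ
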